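/- Let $d\ge 1$, write $|n|=\sum_j|n_j|$ for $n\in\mathbb Z^d$, let $(\delta_n)$ be the standard basis of $\ell^2(\mathbb Z^d)$ and $(T_nu)(m)=u(m-n)$. Let $(\Omega,\mu)$ be a probability space with an ergodic measure-preserving action $(S_n)_{n\in\mathbb Z^d}$, $S_{m+n}=S_mS_n$. Let $(H_\omega)_{\omega\in\Omega}$ be an ergodic covariant family, that is: $(H_\omega)$ is a measurable family of bounded self-adjoint operators on $\ell^2(\mathbb Z^d)$ with $H_{S_n\omega}=T_nH_\omega T_{-n}$, and there are a measurable $E:\Omega\to\mathbb R$ and a map $u:\Omega\to\ell^2(\mathbb Z^d)$ (not necessarily measurable) such that for $\mu$-a.e. $\omega$ one has $\|u(\omega)\|=1$, $H_\omega u(\omega)=E(\omega)u(\omega)$, and the vectors $T_{-k}u(S_k\omega)$, $k\in\mathbb Z^d$, are orthonormal. For $\gamma>0$, $\ell\in\mathbb Z^d$, $C>0$, $0<c<1$, a normalized eigenfunction $v$ of $H_\omega$ is called $(\gamma,\ell,C,c)$-good if $|v(n)|\le C\big(e^{-\gamma|n|}+c\,e^{-\gamma|n+\ell|}\big)$ for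 all $n\in\mathbb Z^d$. Fix $\gamma>0$ and consider the following conditions. 1. There are measurable sets $\Omega_0\subset\Omega_1\subset\cdots\subset\Omega$ with $\mu(\bigcup_i\Omega_i)=1$, integers $n_i$ and constants $C_i$, $C_{i,m}$ such that for every $i\geq 0$ and every $\omega\in\Omega_i$ the vector $u(\omega)$ is a $(\gamma,\ell,C_i,C_{i,m})$-good eigenfunction of $H_\omega$ for some $\ell\in\mathbb Z^d$ with $|\ell|=m<n_i$. 2. $u:\Omega\to\ell^2(\mathbb Z^d)$ is measurable. 3. $\displaystyle\sum_{i=1}^\infty C_i^2\Big(1+\sup_{m<n_i}C_{i,m}e^{\gamma m}\Big)\mu(\Omega\setminus\Omega_{i-1})<\infty$. (a) If (1) holds, then for $\mu$-a.e. $\omega$ the operator $H_\omega$ has Anderson localization: $\ell^2(\mathbb Z^d)$ has an orthonormal basis of eigenvectors $(v_j)$ of $H_\omega$ such that for each $j$ there are $A_j>0$ and $x_j\in\mathbb Z^d$ with $|v_j(n)|\le A_je^{-\gamma|n-x_j|}$ for all $n$. (b) If (1), (2) and (3) hold, then the family has exponential dynamical localization in expectation: there are $C,\eta>0$ with $$\int_\Omega\sup_{t\in\mathbb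 R}|\langle\delta_k,e^{-itH_\omega}\delta_\ell\rangle|\,d\mu\le Ce^{-\eta|k-\ell|}\qquad\text{for all }k,\ell\in\mathbb Z^d,$$ and its decay rate in expectation satisfies $$\gamma(H):=\liminf_{|n|\to\infty}\Big(-\frac1{|n|}\ln\int_\Omega\sup_{t\in\mathbb R}|\langle\delta_n,e^{-itH_\omega}\delta_0\rangle|\,d\mu\Big)\ge\gamma$$ (with $\ln 0=-\infty$). -/

import Mathlib

open MeasureTheory Filter
open scoped ENNReal lp

noncomputable section

namespace EDL

/-- The Hilbert space `ℓ²(ℤ^d)` of complex square-summable sequences. -/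
abbrev L2 (d : ℕ) : Type := lp (fun _ : Fin d → ℤ => ℂ) 2

/-- The `ℓ¹`-norm `|n| = |n_1| + ⋯ + |n_d|` on `ℤ^d`. -/
def absZ {d : ℕ} (n : Fin d → ℤ) : ℕ := ∑ i, (n i).natAbs

/-- The standard basis vector `δ_n`. -/
def delta {d : ℕ} (n : Fin d → ℤ) : L2 d := lp.single 2 n (1 : ℂ)

theorem memlp_translate {d : ℕ} (n : Fin d → ℤ) (u : L2 d) :
    Memℓp (fun m => u (m - n)) 2 := by
  have h := (memℓp_gen_iff (by simp)).1 (lp.memℓp u)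
  exact (memℓp_gen_iff (by simp)).2 (h.comp_injective (sub_left_injective (b := n)))

/-- The translation `T_n` of `ℓ²(ℤ^d)` by the vector `n`: `(T_n u)(m) = u(m - n)`. -/
def translate {d : ℕ} (n : Fin d → ℤ) : L2 d →ₗᵢ[ℂ] L2 d where
  toFun u := ⟨fun m => u (m - n), memlp_translate n u⟩
  map_add' u v := by ext m; rfl
  map_smul' c u := by ext m; rfl
  norm_map' u := by
    have hp : 0 < (2 : ℝ≥0∞).toReal := by simp
    rw [lp.norm_eq_tsum_rpow hp, lp.norm_eq_tsum_rpow hp]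
    congr 1
    exact (Equiv.subRight n).tsum_eq (fun m => ‖u m‖ ^ (2 : ℝ≥0∞).toReal)

variable {d : ℕ} {Ω : Type*} [MeasurableSpace Ω] [AddAction (Fin d → ℤ) Ω]

/-- An ergodic family of bounded self-adjoint operators on `ℓ²(ℤ^d)` over `(Ω, μ)`, where `ℤ^d`
acts on `Ω` by `S_n ω = n +ᵥ ω`: the action is by measurable, measure-preserving maps and is
ergodic, `ω ↦ H_ω` is (weakly) measurable, and `H_{S_n ω} = T_n H_ω T_{-n}`. -/
structure IsErgodicFamily (μ : Measure Ω) (H : Ω → L2 d →L[ℂ] L2 d) : Prop where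
  measurable_action : ∀ n : Fin d → ℤ, Measurable (fun ω : Ω => n +ᵥ ω)
  ergodic : ErgodicVAdd (Fin d → ℤ) Ω μ
  selfAdjoint : ∀ ω, IsSelfAdjoint (H ω)
  measurable : ∀ φ ψ : L2 d, Measurable (fun ω => inner ℂ φ (H ω ψ))
  covariant : ∀ (n : Fin d → ℤ) (ω : Ω) (φ : L2 d),
    H (n +ᵥ ω) φ = translate n (H ω (translate (-n) φ))

/-- An ergodic covariant family `H` with its eigenvalue function `E` (Borel measurable) and its
normalized eigenfunction `u` (not assumed measurable): `H_ω u(ω) = E(ω) u(ω)` and the vectors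
`T_{-k} u(S_k ω)`, `k ∈ ℤ^d`, are orthonormal. The last three conditions are required for almost
every `ω` only. -/
structure IsErgodicCovariantFamily (μ : Measure Ω) (H : Ω → L2 d →L[ℂ] L2 d)
    (E : Ω → ℝ) (u : Ω → L2 d) : Prop extends IsErgodicFamily μ H where
  measurable_eigenvalue : Measurable E
  normalized : ∀ᵐ ω ∂μ, ‖u ω‖ = 1
  eigen : ∀ᵐ ω ∂μ, H ω (u ω) = (E ω : ℂ) • u ω
  orthonormal : ∀ᵐ ω ∂μ,
    Orthonormal ℂ (fun k : Fin d → ℤ => translate (-k) (u (k +ᵥ ω)))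

/-- `u` is a `(γ, ℓ, C, c)`-good eigenfunction of the operator `A`: it is a normalized
eigenfunction and `|u(n)| ≤ C (e^{-γ|n|} + c e^{-γ|n+ℓ|})` for all `n`. -/
structure IsGoodEigenfunction (A : L2 d →L[ℂ] L2 d) (γ : ℝ) (ℓ : Fin d → ℤ) (C c : ℝ)
    (u : L2 d) : Prop where
  gamma_pos : 0 < γ
  C_pos : 0 < C
  c_pos : 0 < c
  c_lt_one : c < 1
  normalized : ‖u‖ = 1
  eigen : ∃ E : ℝ, A u = (E : ℂ) • u
  bound : ∀ n : Fin d → ℤ, ‖u n‖ ≤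
    C * (Real.exp (-γ * absZ n) + c * Real.exp (-γ * absZ (n + ℓ)))

/-- Anderson localization of one operator, with rate `γ`: pure point spectrum with exponentially
decaying eigenfunctions, i.e. there is an orthonormal basis of eigenvectors, each of which decays
like `e^{-γ|n - n₀|}` around a centre `n₀`. -/
def AndersonLocalized (A : L2 d →L[ℂ] L2 d) (γ : ℝ) : Prop :=
  0 < γ ∧ ∃ b : HilbertBasis ℕ ℂ (L2 d), ∀ j : ℕ,
    (∃ E : ℝ, A (b j) = (E : ℂ) • b j) ∧
    ∃ C : ℝ, 0 < C ∧ ∃ n₀ : Fin d → ℤ, ∀ n : Fin d → ℤ,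
      ‖b j n‖ ≤ C * Real.exp (-γ * absZ (n - n₀))

/-- The unitary group `e^{-itA}`. -/
def propagator (A : L2 d →L[ℂ] L2 d) (t : ℝ) : L2 d →L[ℂ] L2 d :=
  NormedSpace.exp ((-(Complex.I * (t : ℂ))) • A)

/-- `∫_Ω sup_{t ∈ ℝ} |⟨δ_k, e^{-itH_ω} δ_ℓ⟩| dμ`, as an element of `[0, ∞]`. -/
def expectedSup (μ : Measure Ω) (H : Ω → L2 d →L[ℂ] L2 d) (k ℓ : Fin d → ℤ) : ℝ≥0∞ :=
  ∫⁻ ω, ⨆ t : ℝ, ENNReal.ofReal ‖inner ℂ (delta k) (propagator (H ω) t (delta ℓ))‖ ∂μ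

/-- Exponential dynamical localization in expectation. -/
def HasEDL (μ : Measure Ω) (H : Ω → L2 d →L[ℂ] L2 d) : Prop :=
  ∃ C η : ℝ, 0 < C ∧ 0 < η ∧ ∀ k ℓ : Fin d → ℤ,
    expectedSup μ H k ℓ ≤ ENNReal.ofReal (C * Real.exp (-η * absZ (k - ℓ)))

/-- The exponential decay rate in expectation
`liminf_{|n| → ∞} -(1/|n|) log ∫_Ω sup_t |⟨δ_n, e^{-itH_ω} δ_0⟩| dμ`, in the extended reals
(with `log 0 = -∞`). -/
def decayRate (μ : Measure Ω) (H : Ω → L2 d →L[ℂ] L2 d) : EReal :=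
  liminf (fun n : Fin d → ℤ => -(ENNReal.log (expectedSup μ H n 0)) / ((absZ n : ℝ) : EReal))
    cofinite

end EDL

end

/-!
Write `v_k(ω) = T_{-k} u(S_k ω)`. By covariance these are orthonormal eigenvectors of `H_ω`, and the
question is whether they, or enough other localized eigenvectors, span `ℓ²(ℤ^d)`.

If `u` is measurable, completeness is mass transport: `∑ₖ |⟨v_k(ω), δ_x⟩|² = ∑ₖ |u(S_k ω)(x + k)|²`
has expectation `∫ ‖u‖² dμ = 1`, while Bessel's inequality bounds it by `1`
(`ae_hasSum_norm_sq_eq_one`).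

Without measurability of `u` this integral makes no sense, and the `v_k` need not be complete: if
eigenvalues have infinite multiplicity, one vector may be dropped from each orbit. Two ideas replace
it. First, the event that `δ_x` is within `r` of a finite sum of eigenvectors of `H_ω` decaying like
`e^{-γ|n|}` does not involve `u`, and it is measurable: the decaying vectors with a given constant
form a compact set, so that the event is a countable union of solvability conditions for
Carathéodory functions on compact spaces (`measurableSet_approxEvent`). Second, where the event
fails, Bessel's inequality for the `v_k` has a defect of at least `r²` at `x`. The functions
`|u(ω)(n)|²` are tight on `Ωs i` uniformly in `ω`, so counting the `v_k` with centres in a large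
cube shows that the defect vanishes on spatial average, and invariance of `μ` makes the event almost
sure (`measure_compl_eq_zero_of_tight`). Hence the localized eigenvectors are total. Gram–Schmidt on
a total sequence of them keeps each vector in its eigenspace, since different eigenspaces are
orthogonal, and keeps the decay (`andersonLocalized_of_dense_span`).

For dynamical localization, expanding in the basis `v_k` bounds `sup_t |⟨δ_k, e^{-itH} δ_l⟩|` by
`∑ⱼ |v_j(k)| |v_j(l)|`, whose expectation is that of `∑ⱼ |u(k + j)| |u(l + j)|`
(`expectedSup_le_lintegral`). For every `η < γ`, on `Ωs i` this sum is at most a constant times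
`C_i² (1 + sup_m c_{i,m} e^{γm}) e^{-η|k - l|}` (`tsum_ofReal_norm_mul_norm_le`). Splitting `Ω` along
the `Ωs i` yields the summability hypothesis, and `η` may be taken arbitrarily close to `γ`.
-/

namespace EDL

/-! ### The `ℓ¹`-norm and boxes in `ℤ^d` -/

lemma absZ_add_le {d : ℕ} (m n : Fin d → ℤ) : absZ (m + n) ≤ absZ m + absZ n := by
  simp only [absZ, ← Finset.sum_add_distrib]
  exact Finset.sum_le_sum fun i _ => Int.natAbs_add_le _ _

lemma absZ_neg {d : ℕ} (n : Fin d → ℤ) : absZ (-n) = absZ n := by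
  simp [absZ]

/-- The exponential weight `e^{-β|n|}` on `ℤ^d`. -/
noncomputable def expWeight {d : ℕ} (β : ℝ) (n : Fin d → ℤ) : ℝ := Real.exp (-β * absZ n)

lemma expWeight_pos {d : ℕ} (β : ℝ) (n : Fin d → ℤ) : 0 < expWeight β n := Real.exp_pos _

lemma expWeight_add_le {d : ℕ} {β : ℝ} (hβ : 0 ≤ β) (m n : Fin d → ℤ) :
    expWeight β (m + n) ≤ Real.exp (β * absZ m) * expWeight β n := by
  have h := absZ_add_le (-m) (m + n)
  rw [neg_add_cancel_left, absZ_neg] at h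
  have h' : (absZ n : ℝ) ≤ absZ m + absZ (m + n) := by exact_mod_cast h
  rw [expWeight, expWeight, ← Real.exp_add]
  exact Real.exp_le_exp.2 (by nlinarith)

/-- Half of the two decaying factors in a convolution is traded for the decay in the difference
`x - y`, the other half is kept for summability. -/
lemma expWeight_mul_expWeight_le {d : ℕ} {γ η : ℝ} (hη : 0 ≤ η) (hηγ : η ≤ γ)
    (x y : Fin d → ℤ) :
    expWeight γ x * expWeight γ y ≤ expWeight η (x - y) * expWeight (γ - η) y := by
  have h := absZ_add_le x (-y)
  rw [absZ_neg, ← sub_eq_add_neg] at h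
  have h' : (absZ (x - y) : ℝ) ≤ absZ x + absZ y := by exact_mod_cast h
  have hx : (0 : ℝ) ≤ absZ x := Nat.cast_nonneg _
  simp only [expWeight, ← Real.exp_add]
  exact Real.exp_le_exp.2 (by nlinarith)

lemma summable_geometric_natAbs {r : ℝ} (h0 : 0 ≤ r) (h1 : r < 1) :
    Summable fun n : ℤ => r ^ n.natAbs := by
  refine Summable.of_nat_of_neg ?_ ?_ <;> simpa using summable_geometric_of_lt_one h0 h1

lemma summable_pow_absZ {r : ℝ} (h0 : 0 ≤ r) (h1 : r < 1) (d : ℕ) :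
    Summable fun n : Fin d → ℤ => r ^ absZ n := by
  induction d with
  | zero => exact (hasSum_fintype _).summable
  | succ d ih =>
    have h := (summable_geometric_natAbs h0 h1).mul_of_nonneg ih
      (fun _ => pow_nonneg h0 _) (fun _ => pow_nonneg h0 _)
    refine ((Fin.consEquiv fun _ : Fin (d + 1) => ℤ).summable_iff).1 (h.congr fun p => ?_)
    simp [absZ, Fin.sum_univ_succ, pow_add, Fin.consEquiv]

lemma summable_expWeight {β : ℝ} (hβ : 0 < β) (d : ℕ) :
    Summable (expWeight β : (Fin d → ℤ) → ℝ) := by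
  refine (summable_pow_absZ (Real.exp_pos (-β)).le (Real.exp_lt_one_iff.2 (by linarith)) d).congr
    fun n => ?_
  rw [expWeight, mul_comm, Real.exp_nat_mul]

lemma summable_expWeight_sq {β : ℝ} (hβ : 0 < β) (d : ℕ) :
    Summable fun n : Fin d → ℤ => expWeight β n ^ 2 := by
  refine (summable_expWeight (β := 2 * β) (by linarith) d).congr fun n => ?_
  rw [expWeight, expWeight, ← Real.exp_nat_mul]
  congr 1
  push_cast
  ring

/-- The cube `[-M, M]^d` in `ℤ^d`. -/
noncomputable def box (d M : ℕ) : Finset (Fin d → ℤ) :=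
  Finset.Icc (fun _ => -(M : ℤ)) (fun _ => (M : ℤ))

lemma mem_box {d M : ℕ} {n : Fin d → ℤ} : n ∈ box d M ↔ ∀ i, (n i).natAbs ≤ M := by
  simp only [box, Finset.mem_Icc, Pi.le_def, ← forall_and]
  exact forall_congr' fun i => by omega

lemma card_box (d M : ℕ) : (box d M).card = (2 * M + 1) ^ d := by
  rw [box, Pi.card_Icc]
  simp only [Int.card_Icc, Finset.prod_const, Finset.card_univ, Fintype.card_fin]
  congr 1
  omega

lemma natAbs_le_absZ {d : ℕ} (n : Fin d → ℤ) (i : Fin d) : (n i).natAbs ≤ absZ n :=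
  Finset.single_le_sum (f := fun i => (n i).natAbs) (fun _ _ => Nat.zero_le _) (Finset.mem_univ i)

lemma mem_box_absZ {d : ℕ} (n : Fin d → ℤ) : n ∈ box d (absZ n) :=
  mem_box.2 (natAbs_le_absZ n)

lemma box_mono {d M M' : ℕ} (h : M ≤ M') : box d M ⊆ box d M' :=
  fun _ hn => mem_box.2 fun i => (mem_box.1 hn i).trans h

lemma exists_subset_box {d : ℕ} (s : Finset (Fin d → ℤ)) : ∃ M, s ⊆ box d M :=
  ⟨s.sup absZ, fun n hn => box_mono (Finset.le_sup (f := absZ) hn) (mem_box_absZ n)⟩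

lemma tendsto_absZ_cofinite (d : ℕ) : Tendsto (absZ : (Fin d → ℤ) → ℕ) cofinite atTop := by
  refine tendsto_atTop.2 fun M => ?_
  refine (box d M).finite_toSet.subset fun n hn => ?_
  have h : absZ n < M := not_le.1 hn
  exact box_mono h.le (mem_box_absZ n)

lemma tendsto_card_box_ratio (d R : ℕ) :
    Tendsto (fun L : ℕ => ((box d L).card : ℝ) / (box d (L + R)).card) atTop (nhds 1) := by
  have h : Tendsto (fun L : ℕ => (1 - (2 * R : ℝ) / (2 * (L + R : ℕ) + 1)) ^ d) atTop
      (nhds ((1 - 0) ^ d)) := by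
    refine (tendsto_const_nhds.sub (tendsto_const_nhds.div_atTop ?_)).pow d
    refine tendsto_atTop_mono (fun L => ?_) tendsto_natCast_atTop_atTop
    push_cast
    nlinarith [(Nat.cast_nonneg L : (0 : ℝ) ≤ L), (Nat.cast_nonneg R : (0 : ℝ) ≤ R)]
  simp only [sub_zero, one_pow] at h
  refine h.congr fun L => ?_
  rw [card_box, card_box, Nat.cast_pow, Nat.cast_pow, ← div_pow]
  congr 1
  have : (0 : ℝ) < 2 * (L + R : ℕ) + 1 := by positivity
  push_cast at *
  field_simp
  ring

/-! ### Mass transport without measurability -/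

/-- Let `a ω n ≥ 0` be a weight at the site `n`. The sites `-k` send the masses
`a (k +ᵥ ω) (n + k)` to `n`. If the weights are tight, nearly all the mass that starts in a large
cube stays close to the cube, so a site receives total mass at least `1 - ε` on spatial average.
Hence an event `Gᶜ` on which the mass received falls short of `1` by a fixed `r > 0` is null.
Only `G` has to be measurable: the weight enters through finite sums along a single orbit. -/
lemma measure_compl_eq_zero_of_tight {d : ℕ} {Ω : Type*} [MeasurableSpace Ω]
    [AddAction (Fin d → ℤ) Ω] {μ : Measure Ω} [IsProbabilityMeasure μ]
    (hS : ∀ n : Fin d → ℤ, MeasurePreserving (fun ω : Ω => n +ᵥ ω) μ μ)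
    {a : Ω → (Fin d → ℤ) → ℝ} (ha : ∀ ω n, 0 ≤ a ω n)
    {G : Set Ω} (hG : MeasurableSet G) (x : Fin d → ℤ) {r : ℝ} (hr : 0 < r)
    (hbound : ∀ᵐ ω ∂μ, ∀ s : Finset (Fin d → ℤ),
      Gᶜ.indicator (fun _ => r) ω + ∑ k ∈ s, a (k +ᵥ ω) (x + k) ≤ 1)
    (htight : ∀ ε : ℝ, 0 < ε → ∃ W : Set Ω, MeasurableSet W ∧ 1 - ε ≤ μ.real W ∧
      ∃ R : ℕ, ∀ ω ∈ W, 1 - ε ≤ ∑ n ∈ box d R, a ω n) :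
    μ Gᶜ = 0 := by
  have hsum : ∀ᵐ ω ∂μ, ∀ (n : Fin d → ℤ) (s : Finset (Fin d → ℤ)),
      Gᶜ.indicator (fun _ => r) ((x - n) +ᵥ ω) + ∑ k ∈ s, a (k +ᵥ ω) (n + k) ≤ 1 := by
    refine ae_all_iff.2 fun n => ?_
    filter_upwards [(hS (x - n)).quasiMeasurePreserving.ae hbound] with ω hω s
    have h := hω (s.map (Equiv.addRight (n - x)).toEmbedding)
    rw [Finset.sum_map] at h
    refine le_trans (le_of_eq ?_) h
    congr 1
    refine Finset.sum_congr rfl fun k _ => ?_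
    rw [Equiv.coe_toEmbedding, Equiv.coe_addRight, vadd_vadd,
      show k + (n - x) + (x - n) = k by abel, show x + (k + (n - x)) = n + k by abel]
  -- Sum over the receiving sites `n` in a cube of side `L + R`, integrate, and let `L → ∞`.
  have key : ∀ ε : ℝ, 0 < ε → ε < 1 → r * μ.real Gᶜ ≤ 1 - (1 - ε) * (1 - ε) := by
    intro ε hε hε1
    obtain ⟨W, hW, hμW, R, hR⟩ := htight ε hε
    have hL : ∀ L : ℕ, r * μ.real Gᶜ ≤
        1 - (1 - ε) * (1 - ε) * (((box d L).card : ℝ) / (box d (L + R)).card) := by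
      intro L
      have hpt : ∀ᵐ ω ∂μ, ∑ n ∈ box d (L + R), Gᶜ.indicator (fun _ => r) ((x - n) +ᵥ ω) +
          ∑ k ∈ box d L, W.indicator (fun _ => 1 - ε) (k +ᵥ ω) ≤ ((box d (L + R)).card : ℝ) := by
        filter_upwards [hsum] with ω hω
        have h1 := Finset.sum_le_sum fun n (_ : n ∈ box d (L + R)) => hω n (box d L)
        rw [Finset.sum_add_distrib, Finset.sum_comm, Finset.sum_const, nsmul_eq_mul, mul_one] at h1
        refine le_trans (add_le_add_right (Finset.sum_le_sum fun k hk => ?_) _) h1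
        by_cases hkW : k +ᵥ ω ∈ W
        · rw [Set.indicator_of_mem hkW]
          refine (hR _ hkW).trans ?_
          refine le_of_le_of_eq ?_
            (Finset.sum_map (box d (L + R)) (Equiv.addRight k).toEmbedding (a (k +ᵥ ω)))
          refine Finset.sum_le_sum_of_subset_of_nonneg (fun n hn => ?_) fun n _ _ => ha _ n
          refine Finset.mem_map.2 ⟨n - k, mem_box.2 fun i => ?_, by simp⟩
          have h2 := mem_box.1 hn i
          have h3 := mem_box.1 hk i
          rw [Pi.sub_apply]
          omega
        · rw [Set.indicator_of_notMem hkW]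
          exact Finset.sum_nonneg fun n _ => ha _ _
      have hint : ∀ {A : Set Ω} (_ : MeasurableSet A) (t : ℝ) (n : Fin d → ℤ),
          Integrable (fun ω => A.indicator (fun _ => t) (n +ᵥ ω)) μ := fun hA t n =>
        ((hS n).integrable_comp_of_integrable ((integrable_const t).indicator hA))
      have hval : ∀ {A : Set Ω} (_ : MeasurableSet A) (t : ℝ) (n : Fin d → ℤ),
          ∫ ω, A.indicator (fun _ => t) (n +ᵥ ω) ∂μ = μ.real A * t := by
        intro A hA t n
        have h := integral_indicator_const (μ := μ) t ((hS n).measurable hA)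
        rw [(hS n).measureReal_preimage hA.nullMeasurableSet, smul_eq_mul] at h
        exact h
      have hI := integral_mono_ae ((integrable_finsetSum _ fun n _ => hint hG.compl r (x - n)).add
        (integrable_finsetSum _ fun k _ => hint hW (1 - ε) k)) (integrable_const _) hpt
      have hI' : ((box d (L + R)).card : ℝ) * (μ.real Gᶜ * r) +
          (box d L).card * (μ.real W * (1 - ε)) ≤ (box d (L + R)).card := by
        have h1 := integral_add (μ := μ)
          (integrable_finsetSum (box d (L + R)) fun n _ => hint hG.compl r (x - n))
          (integrable_finsetSum (box d L) fun k _ => hint hW (1 - ε) k)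
        rw [integral_finsetSum _ fun n _ => hint hG.compl r (x - n),
          integral_finsetSum _ fun k _ => hint hW (1 - ε) k] at h1
        simp only [hval hG.compl, hval hW, Finset.sum_const, nsmul_eq_mul] at h1
        rw [← h1]
        simpa using hI
      have hpos : (0 : ℝ) < (box d (L + R)).card := by rw [card_box]; positivity
      have hW' : (1 - ε) * (1 - ε) ≤ μ.real W * (1 - ε) :=
        mul_le_mul_of_nonneg_right hμW (by linarith)
      have hc : (0 : ℝ) ≤ (box d L).card := Nat.cast_nonneg _
      have h4 := mul_le_mul_of_nonneg_left hW' hc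
      rw [le_sub_iff_add_le, ← mul_le_mul_iff_of_pos_left hpos]
      calc ((box d (L + R)).card : ℝ) * (r * μ.real Gᶜ + (1 - ε) * (1 - ε) *
            (((box d L).card : ℝ) / (box d (L + R)).card))
          = ((box d (L + R)).card : ℝ) * (μ.real Gᶜ * r) +
            (box d L).card * ((1 - ε) * (1 - ε)) := by field_simp
        _ ≤ _ := by linarith
    have hlim := (tendsto_card_box_ratio d R).const_mul ((1 - ε) * (1 - ε))
    have := ge_of_tendsto' (hlim.const_sub 1) hL
    simpa using this
  have hlim : Tendsto (fun ε : ℝ => 1 - (1 - ε) * (1 - ε)) (nhdsWithin 0 (Set.Ioi 0)) (nhds 0) := by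
    have : Continuous fun ε : ℝ => 1 - (1 - ε) * (1 - ε) := by fun_prop
    simpa using (this.tendsto 0).mono_left nhdsWithin_le_nhds
  have hle : r * μ.real Gᶜ ≤ 0 := by
    refine ge_of_tendsto hlim ?_
    filter_upwards [Ioo_mem_nhdsGT (zero_lt_one' ℝ)] with ε hε using key ε hε.1 hε.2
  have h0 : μ.real Gᶜ = 0 :=
    le_antisymm (nonpos_of_mul_nonpos_right hle hr) measureReal_nonneg
  exact (measureReal_eq_zero_iff).1 h0

/-! ### Coordinates in `ℓ²(ℤ^d)` -/

lemma inner_delta {d : ℕ} (n : Fin d → ℤ) (v : L2 d) : inner ℂ (delta n) v = v n := by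
  simp [delta, lp.inner_single_left]

lemma norm_inner_delta_right {d : ℕ} (n : Fin d → ℤ) (v : L2 d) :
    ‖inner ℂ v (delta n)‖ = ‖v n‖ := by
  rw [norm_inner_symm, inner_delta]

lemma norm_delta {d : ℕ} (n : Fin d → ℤ) : ‖delta n‖ = 1 := by
  rw [delta, lp.norm_single (by norm_num)]
  simp

lemma continuous_coord {d : ℕ} (n : Fin d → ℤ) : Continuous fun v : L2 d => v n := by
  simp only [← inner_delta]
  fun_prop

lemma hasSum_norm_sq {d : ℕ} (v : L2 d) : HasSum (fun n => ‖v n‖ ^ 2) (‖v‖ ^ 2) := by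
  simpa using lp.hasSum_norm (p := 2) (by norm_num) v

lemma hasSum_smul_delta {d : ℕ} (v : L2 d) : HasSum (fun n => v n • delta n) v := by
  have h (n : Fin d → ℤ) : v n • delta n = lp.single 2 n (v n) := by
    rw [delta, ← lp.single_smul, smul_eq_mul, mul_one]
  simpa only [h] using lp.hasSum_single (by norm_num) v

lemma tsum_ofReal_norm_sq {d : ℕ} (v : L2 d) :
    ∑' n, ENNReal.ofReal (‖v n‖ ^ 2) = ENNReal.ofReal (‖v‖ ^ 2) := by
  rw [← (hasSum_norm_sq v).tsum_eq,
    ENNReal.ofReal_tsum_of_nonneg (fun _ => sq_nonneg _) (hasSum_norm_sq v).summable]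

/-- A weakly measurable `ℓ²`-valued map has measurable norm. -/
lemma measurable_norm_of_coord {d : ℕ} {Ω : Type*} [MeasurableSpace Ω] {f : Ω → L2 d}
    (hf : ∀ n, Measurable fun ω => f ω n) : Measurable fun ω => ‖f ω‖ := by
  have h : (fun ω => ‖f ω‖) =
      fun ω => √(∑' n, ENNReal.ofReal (‖f ω n‖ ^ 2)).toReal := by
    funext ω
    rw [tsum_ofReal_norm_sq, ENNReal.toReal_ofReal (sq_nonneg _), Real.sqrt_sq (norm_nonneg _)]
  rw [h]
  exact (Measurable.tsum fun n => ((hf n).norm.pow_const 2).ennreal_ofReal).ennreal_toReal.sqrt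

lemma eq_top_of_delta_mem {d : ℕ} {K : Submodule ℂ (L2 d)} (hK : IsClosed (K : Set (L2 d)))
    (h : ∀ n, delta n ∈ K) : K = ⊤ :=
  eq_top_iff.2 fun v _ => hK.mem_of_tendsto (hasSum_smul_delta v)
    (Eventually.of_forall fun _ => K.sum_mem fun n _ => K.smul_mem _ (h n))

lemma orthonormal_delta (d : ℕ) : Orthonormal ℂ (delta : (Fin d → ℤ) → L2 d) := by
  refine ⟨norm_delta, fun m n hmn => ?_⟩
  change inner ℂ (delta m) (delta n) = 0
  rw [inner_delta]
  exact lp.single_apply_ne _ _ _ hmn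

/-- The defect in Bessel's inequality. -/
lemma norm_sub_sum_sq {E ι : Type*} [NormedAddCommGroup E] [InnerProductSpace ℂ E] {v : ι → E}
    (hv : Orthonormal ℂ v) (x : E) (s : Finset ι) :
    ‖x - ∑ i ∈ s, inner ℂ (v i) x • v i‖ ^ 2 = ‖x‖ ^ 2 - ∑ i ∈ s, ‖inner ℂ (v i) x‖ ^ 2 := by
  set p := ∑ i ∈ s, inner ℂ (v i) x • v i with hp
  have hnorm : ‖p‖ ^ 2 = ∑ i ∈ s, ‖inner ℂ (v i) x‖ ^ 2 := by
    have := hv.inner_sum (fun i => inner ℂ (v i) x) (fun i => inner ℂ (v i) x) s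
    rw [← hp, inner_self_eq_norm_sq_to_K] at this
    simp only [RCLike.conj_mul] at this
    exact_mod_cast this
  have horth : inner ℂ p (x - p) = 0 := by
    have h1 : inner ℂ p x = inner ℂ p p := by
      rw [hp, hv.inner_sum, sum_inner]
      simp [inner_smul_left]
    rw [inner_sub_right, h1, sub_self]
  have h := norm_add_sq_eq_norm_sq_add_norm_sq_of_inner_eq_zero p (x - p) horth
  rw [add_sub_cancel] at h
  rw [← hnorm]
  linarith [sq ‖x‖, sq ‖p‖, sq ‖x - p‖]

/-! ### Localized eigenvectors -/

/-- The eigenvectors of `A` for the eigenvalue `e` (and zero) that decay at least like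
`e^{-γ|n|}`, with an arbitrary constant. As `e^{-γ|n - x|} ≤ e^{γ|x|} e^{-γ|n|}`, the centre of
decay can be taken to be the origin. -/
def localizedEigenspace {d : ℕ} (A : L2 d →L[ℂ] L2 d) (γ e : ℝ) : Submodule ℂ (L2 d) where
  carrier := {v | A v = (e : ℂ) • v ∧ ∃ M : ℝ, ∀ n, ‖v n‖ ≤ M * expWeight γ n}
  zero_mem' := ⟨by simp, 0, by simp⟩
  add_mem' := by
    rintro v w ⟨hv, M, hM⟩ ⟨hw, M', hM'⟩
    refine ⟨by rw [map_add, hv, hw, smul_add], M + M', fun n => ?_⟩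
    rw [add_mul]
    exact (norm_add_le _ _).trans (add_le_add (hM n) (hM' n))
  smul_mem' := by
    rintro c v ⟨hv, M, hM⟩
    refine ⟨by rw [map_smul, hv, smul_comm], ‖c‖ * M, fun n => ?_⟩
    rw [mul_assoc]
    exact (norm_smul_le c (v n)).trans (mul_le_mul_of_nonneg_left (hM n) (norm_nonneg _))

lemma inner_eq_zero_of_mem_localizedEigenspace {d : ℕ} {A : L2 d →L[ℂ] L2 d}
    (hA : IsSelfAdjoint A) {γ e e' : ℝ} (hne : e ≠ e') {v w : L2 d}
    (hv : v ∈ localizedEigenspace A γ e) (hw : w ∈ localizedEigenspace A γ e') :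
    inner ℂ v w = 0 := by
  have h := hA.isSymmetric v w
  rw [ContinuousLinearMap.coe_coe, hv.1, hw.1, inner_smul_left, inner_smul_right,
    Complex.conj_ofReal, ← sub_eq_zero, ← sub_mul] at h
  exact (mul_eq_zero.1 h).resolve_left (sub_ne_zero.2 (by exact_mod_cast hne))

/-- Gram–Schmidt, applied to a sequence of localized eigenvectors, never mixes different
eigenvalues, since eigenvectors for different eigenvalues are already orthogonal. -/
lemma gramSchmidt_mem_localizedEigenspace {d : ℕ} {A : L2 d →L[ℂ] L2 d}
    (hA : IsSelfAdjoint A) {γ : ℝ} {f : ℕ → L2 d} {e : ℕ → ℝ}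
    (hf : ∀ n, f n ∈ localizedEigenspace A γ (e n)) (n : ℕ) :
    InnerProductSpace.gramSchmidt ℂ f n ∈ localizedEigenspace A γ (e n) := by
  induction n using Nat.strong_induction_on with
  | _ n ih =>
    rw [eq_sub_of_add_eq (InnerProductSpace.gramSchmidt_def'' ℂ f n).symm]
    refine Submodule.sub_mem _ (hf n) (Submodule.sum_mem _ fun i hi => ?_)
    have hmem := ih i (Finset.mem_Iio.1 hi)
    by_cases he : e i = e n
    · rw [he] at hmem
      exact Submodule.smul_mem _ _ hmem
    · rw [inner_eq_zero_of_mem_localizedEigenspace hA he hmem (hf n)]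
      simp

lemma andersonLocalized_of_dense_span {d : ℕ} (hd : 0 < d) {A : L2 d →L[ℂ] L2 d}
    (hA : IsSelfAdjoint A) {γ : ℝ} (hγ : 0 < γ) {f : ℕ → L2 d} {e : ℕ → ℝ}
    (hf : ∀ n, f n ∈ localizedEigenspace A γ (e n))
    (hdense : (Submodule.span ℂ (Set.range f)).topologicalClosure = ⊤) :
    AndersonLocalized A γ := by
  set g := InnerProductSpace.gramSchmidtNormed ℂ f with hg
  have hgmem : ∀ n, g n ∈ localizedEigenspace A γ (e n) := fun n =>
    Submodule.smul_mem _ _ (gramSchmidt_mem_localizedEigenspace hA hf n)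
  have hspan : Submodule.span ℂ (Set.range fun i : {i | g i ≠ 0} => g i) =
      Submodule.span ℂ (Set.range f) := by
    rw [← InnerProductSpace.span_gramSchmidt ℂ f, ← InnerProductSpace.span_gramSchmidtNormed_range,
      ← Submodule.span_sdiff_singleton_zero (s := Set.range g)]
    congr 1
    ext v
    constructor
    · rintro ⟨⟨i, hi⟩, rfl⟩
      exact ⟨⟨i, rfl⟩, hi⟩
    · rintro ⟨⟨i, rfl⟩, hi⟩
      exact ⟨⟨i, hi⟩, rfl⟩
  have hinf : Infinite {i | g i ≠ 0} := by
    by_contra hfin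
    rw [not_infinite_iff_finite] at hfin
    have : FiniteDimensional ℂ (Submodule.span ℂ (Set.range f)) := by
      rw [← hspan]
      exact FiniteDimensional.span_of_finite ℂ (Set.finite_range _)
    rw [(Submodule.closed_of_finiteDimensional _).submodule_topologicalClosure_eq] at hdense
    rw [hdense] at this
    have : FiniteDimensional ℂ (L2 d) := (Submodule.topEquiv (R := ℂ) (M := L2 d)).finiteDimensional
    have : Nonempty (Fin d) := ⟨⟨0, hd⟩⟩
    exact not_finite_iff_infinite.2 (inferInstance : Infinite (Fin d → ℤ))
      (orthonormal_delta d).linearIndependent.finite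
  obtain ⟨φ⟩ := nonempty_equiv_of_countable (α := ℕ) (β := {i | g i ≠ 0})
  have hon : Orthonormal ℂ fun j : ℕ => g (φ j) :=
    (InnerProductSpace.gramSchmidtNormed_orthonormal' f).comp φ φ.injective
  have hrange : Set.range (fun j : ℕ => g (φ j)) = Set.range fun i : {i | g i ≠ 0} => g i :=
    φ.surjective.range_comp fun i : {i | g i ≠ 0} => g i
  refine ⟨hγ, HilbertBasis.mk hon (by rw [hrange, hspan, hdense]), fun j => ?_⟩
  rw [HilbertBasis.coe_mk]
  obtain ⟨he, M, hM⟩ := hgmem (φ j)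
  refine ⟨⟨_, he⟩, |M| + 1, by positivity, 0, fun n => (hM n).trans ?_⟩
  rw [sub_zero]
  exact mul_le_mul_of_nonneg_right (by linarith [le_abs_self M]) (Real.exp_pos _).le

/-! ### Measurability of approximation by localized eigenvectors -/

lemma isCompact_setOf_norm_le_expWeight (d : ℕ) {γ : ℝ} (hγ : 0 < γ) (M : ℝ) :
    IsCompact {v : L2 d | ∀ n, ‖v n‖ ≤ M * expWeight γ n} := by
  let Y : Set ((Fin d → ℤ) → ℂ) :=
    Set.pi Set.univ fun n => Metric.closedBall 0 (M * expWeight γ n)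
  have hY : IsCompact Y := isCompact_univ_pi fun n => isCompact_closedBall _ _
  have hcont : ContinuousOn (fun y : (Fin d → ℤ) → ℂ => ∑' n, (y n • delta n : L2 d)) Y := by
    refine continuousOn_tsum (u := fun n => M * expWeight γ n)
      (fun n => ((continuous_apply n).smul continuous_const).continuousOn)
      ((summable_expWeight hγ d).mul_left M) fun n y hy => ?_
    rw [norm_smul, norm_delta, mul_one]
    simpa using hy n (Set.mem_univ n)
  refine (hY.image_of_continuousOn hcont).of_isClosed_subset ?_ fun v hv =>
    ⟨v, fun n _ => by simpa using hv n, (hasSum_smul_delta v).tsum_eq⟩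
  rw [Set.ofPred_forall]
  exact isClosed_iInter fun n => isClosed_le (continuous_coord n).norm continuous_const

/-- The zeros of a nonnegative Carathéodory function can be detected on a countable dense subset
of the compact parameter space. -/
lemma measurableSet_exists_eq_zero {Ω Y : Type*} [MeasurableSpace Ω] [TopologicalSpace Y]
    [CompactSpace Y] [TopologicalSpace.SeparableSpace Y] {F : Ω → Y → ℝ}
    (hF : ∀ ω y, 0 ≤ F ω y) (hcont : ∀ ω, Continuous (F ω))
    (hmeas : ∀ y, Measurable fun ω => F ω y) : MeasurableSet {ω | ∃ y, F ω y = 0} := by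
  obtain ⟨D, hDc, hD⟩ := TopologicalSpace.exists_countable_dense Y
  have h : {ω | ∃ y, F ω y = 0} = ⋂ j : ℕ, ⋃ y ∈ D, {ω | F ω y < 1 / ((j : ℝ) + 1)} := by
    ext ω
    simp only [Set.mem_ofPred_eq, Set.mem_iInter, Set.mem_iUnion, exists_prop]
    constructor
    · rintro ⟨y, hy⟩ j
      obtain ⟨z, hz, hzD⟩ := hD.inter_open_nonempty _
        (isOpen_lt (hcont ω) (continuous_const (y := 1 / ((j : ℝ) + 1))))
        ⟨y, by rw [Set.mem_ofPred_eq, hy]; positivity⟩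
      exact ⟨z, hzD, hz⟩
    · intro hω
      obtain ⟨y₀, -⟩ := hω 0
      obtain ⟨y, -, hy⟩ := isCompact_univ.exists_isMinOn ⟨y₀, Set.mem_univ _⟩
        (hcont ω).continuousOn
      refine ⟨y, le_antisymm (le_of_forall_pos_le_add fun ε hε => ?_) (hF ω y)⟩
      obtain ⟨j, hj⟩ := exists_nat_one_div_lt hε
      obtain ⟨z, -, hz⟩ := hω j
      rw [zero_add]
      exact (hy (Set.mem_univ z)).trans (hz.trans hj).le
  rw [h]
  exact MeasurableSet.iInter fun j => MeasurableSet.biUnion hDc fun y _ =>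
    measurableSet_lt (hmeas y) measurable_const

/-- The event that `δ_x` is within distance `r` of a finite sum of localized eigenvectors of
`H_ω`. The summands are labelled by a finite set of sites, as the `T_{-k} u(S_k ω)` are. -/
def approxEvent {d : ℕ} {Ω : Type*} (H : Ω → L2 d →L[ℂ] L2 d) (γ : ℝ) (x : Fin d → ℤ) (r : ℝ) :
    Set Ω :=
  {ω | ∃ (s : Finset (Fin d → ℤ)) (v : s → L2 d) (e : s → ℝ),
    (∀ k, v k ∈ localizedEigenspace (H ω) γ (e k)) ∧ ‖delta x - ∑ k, v k‖ ≤ r}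

/-- Once the constants of decay and the eigenvalues are bounded by `M`, the finite families of
vectors and eigenvalues range over a compact space, which does not depend on `ω`. -/
lemma measurableSet_approxEvent {d : ℕ} {Ω : Type*} [MeasurableSpace Ω]
    {H : Ω → L2 d →L[ℂ] L2 d} (hH : ∀ φ ψ : L2 d, Measurable fun ω => inner ℂ φ (H ω ψ))
    {γ : ℝ} (hγ : 0 < γ) (x : Fin d → ℤ) (r : ℝ) : MeasurableSet (approxEvent H γ x r) := by
  let X (M : ℕ) : Set (L2 d) := {v | ∀ n, ‖v n‖ ≤ M * expWeight γ n}
  have hX (M : ℕ) : CompactSpace (X M) :=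
    isCompact_iff_compactSpace.1 (isCompact_setOf_norm_le_expWeight d hγ M)
  let F (M : ℕ) (s : Finset (Fin d → ℤ)) (ω : Ω)
      (y : s → X M × Set.Icc (-(M : ℝ)) M) : ℝ :=
    ∑ k, ‖H ω (y k).1 - (((y k).2 : ℝ) : ℂ) • ((y k).1 : L2 d)‖ +
      max 0 (‖delta x - ∑ k, ((y k).1 : L2 d)‖ - r)
  have hF0 (M s ω y) : 0 ≤ F M s ω y :=
    add_nonneg (Finset.sum_nonneg fun _ _ => norm_nonneg _) (le_max_left _ _)
  have hEq : approxEvent H γ x r = ⋃ s, ⋃ M, {ω | ∃ y, F M s ω y = 0} := by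
    ext ω
    simp only [approxEvent, Set.mem_ofPred_eq, Set.mem_iUnion]
    refine exists_congr fun s => ⟨?_, ?_⟩
    · rintro ⟨v, e, hv, hr⟩
      choose A hA using fun k => (hv k).2
      obtain ⟨M, hM⟩ := exists_nat_ge (∑ k, (|A k| + |e k|))
      have hle (k) : |A k| + |e k| ≤ M := le_trans
        (Finset.single_le_sum (f := fun k => |A k| + |e k|) (fun _ _ => by positivity)
          (Finset.mem_univ k)) hM
      refine ⟨M, fun k => (⟨v k, fun n => (hA k n).trans ?_⟩, ⟨e k, abs_le.1 ?_⟩), ?_⟩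
      · exact mul_le_mul_of_nonneg_right
          (by linarith [hle k, le_abs_self (A k), abs_nonneg (e k)]) (expWeight_pos _ _).le
      · linarith [hle k, abs_nonneg (A k)]
      · simp only [F, (hv _).1, sub_self, norm_zero, Finset.sum_const_zero, zero_add]
        exact max_eq_left (sub_nonpos.2 hr)
    · rintro ⟨M, y, hy⟩
      obtain ⟨h1, h2⟩ := (add_eq_zero_iff_of_nonneg
        (Finset.sum_nonneg fun _ _ => norm_nonneg _) (le_max_left _ _)).1 hy
      rw [Finset.sum_eq_zero_iff_of_nonneg fun _ _ => norm_nonneg _] at h1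
      refine ⟨fun k => (y k).1, fun k => (y k).2, fun k =>
        ⟨sub_eq_zero.1 (norm_eq_zero.1 (h1 k (Finset.mem_univ k))), M, (y k).1.2⟩, ?_⟩
      exact sub_nonpos.1 (max_eq_left_iff.1 h2)
  rw [hEq]
  refine MeasurableSet.iUnion fun s => MeasurableSet.iUnion fun M =>
    measurableSet_exists_eq_zero (hF0 M s) (fun ω => ?_) fun y => ?_
  · fun_prop
  · refine (Finset.measurable_sum _ fun k _ => ?_).add measurable_const
    refine measurable_norm_of_coord fun n => ?_
    have h := hH (delta n) (y k).1
    simp only [inner_delta] at h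
    exact h.sub_const _

/-! ### Anderson localization -/

lemma IsErgodicFamily.measurePreserving {d : ℕ} {Ω : Type*} [MeasurableSpace Ω]
    [AddAction (Fin d → ℤ) Ω] {μ : Measure Ω} {H : Ω → L2 d →L[ℂ] L2 d}
    (hH : IsErgodicFamily μ H) (n : Fin d → ℤ) :
    MeasurePreserving (fun ω : Ω => n +ᵥ ω) μ μ := by
  refine ⟨hH.measurable_action n, Measure.ext fun s hs => ?_⟩
  rw [Measure.map_apply (hH.measurable_action n) hs]
  exact hH.ergodic.measure_preimage_vadd n hs

lemma translate_neg_apply {d : ℕ} (k : Fin d → ℤ) (v : L2 d) (x : Fin d → ℤ) :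
    translate (-k) v x = v (x + k) := by
  rw [← sub_neg_eq_add]
  rfl

lemma IsErgodicFamily.apply_translate_eigenvector {d : ℕ} {Ω : Type*} [MeasurableSpace Ω]
    [AddAction (Fin d → ℤ) Ω] {μ : Measure Ω} {H : Ω → L2 d →L[ℂ] L2 d}
    (hH : IsErgodicFamily μ H) {k : Fin d → ℤ} {ω : Ω} {v : L2 d} {e : ℂ}
    (hv : H (k +ᵥ ω) v = e • v) :
    H ω (translate (-k) v) = e • translate (-k) v := by
  rw [hH.covariant] at hv
  refine (translate k).injective ?_
  rw [hv, map_smul]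
  congr 1
  ext x
  rw [← neg_neg k, translate_neg_apply, neg_neg, translate_neg_apply, neg_add_cancel_right]

/-- If `δ_x` is further than `r` from all finite sums of localized eigenvectors, then in
particular from the span of the orthonormal system `T_{-k} u(S_k ω)`, and the defect in Bessel's
inequality is at least `r ^ 2`. -/
lemma indicator_approxEvent_add_sum_le {d : ℕ} {Ω : Type*} [AddAction (Fin d → ℤ) Ω]
    {H : Ω → L2 d →L[ℂ] L2 d} {u : Ω → L2 d} {γ r : ℝ} (hr : 0 ≤ r) (x : Fin d → ℤ) {ω : Ω}
    (hon : Orthonormal ℂ fun k : Fin d → ℤ => translate (-k) (u (k +ᵥ ω))) {e : (Fin d → ℤ) → ℝ}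
    (hmem : ∀ k, translate (-k) (u (k +ᵥ ω)) ∈ localizedEigenspace (H ω) γ (e k))
    (s : Finset (Fin d → ℤ)) :
    (approxEvent H γ x r)ᶜ.indicator (fun _ => r ^ 2) ω +
      ∑ k ∈ s, ‖u (k +ᵥ ω) (x + k)‖ ^ 2 ≤ 1 := by
  have h := norm_sub_sum_sq hon (delta x) s
  simp only [norm_inner_delta_right, translate_neg_apply, norm_delta, one_pow] at h
  rw [← le_sub_iff_add_le, ← h]
  by_cases hω : ω ∈ approxEvent H γ x r
  · rw [Set.indicator_of_notMem (by simpa using hω)]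
    positivity
  · rw [Set.indicator_of_mem (by simpa using hω)]
    refine pow_le_pow_left₀ hr (le_of_not_ge fun hle => hω ?_) 2
    rw [← Finset.sum_coe_sort] at hle
    exact ⟨s, _, fun k => e k, fun k => Submodule.smul_mem _ _ (hmem k), hle⟩

lemma exists_box_le_sum_norm_sq {d : ℕ} {γ : ℝ} (hγ : 0 < γ) (A : ℝ) {ε : ℝ} (hε : 0 < ε) :
    ∃ R : ℕ, ∀ v : L2 d, ‖v‖ = 1 → (∀ n, ‖v n‖ ≤ A * expWeight γ n) →
      1 - ε ≤ ∑ n ∈ box d R, ‖v n‖ ^ 2 := by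
  have hD : HasSum (fun n : Fin d → ℤ => (A * expWeight γ n) ^ 2)
      (∑' n : Fin d → ℤ, (A * expWeight γ n) ^ 2) := by
    refine Summable.hasSum ?_
    simp only [mul_pow]
    exact (summable_expWeight_sq hγ d).mul_left _
  obtain ⟨s, hs⟩ := eventually_atTop.1 (hD.eventually (lt_mem_nhds (sub_lt_self _ hε)))
  obtain ⟨R, hR⟩ := exists_subset_box s
  refine ⟨R, fun v hv hvA => ?_⟩
  have h1 := hs _ hR
  have h2 := sum_le_hasSum (box d R) (fun n _ => sub_nonneg.2
    (pow_le_pow_left₀ (norm_nonneg _) (hvA n) 2)) (hD.sub (hasSum_norm_sq v))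
  rw [Finset.sum_sub_distrib, hv, one_pow] at h2
  linarith

/-- If localized eigenvectors approximate every `δ_x`, then countably many of them are total. -/
lemma andersonLocalized_of_forall_mem_approxEvent {d : ℕ} (hd : 0 < d) {Ω : Type*}
    {H : Ω → L2 d →L[ℂ] L2 d} {ω : Ω} (hA : IsSelfAdjoint (H ω)) {γ : ℝ} (hγ : 0 < γ)
    (h : ∀ (x : Fin d → ℤ) (j : ℕ), ω ∈ approxEvent H γ x (1 / ((j : ℝ) + 1))) :
    AndersonLocalized (H ω) γ := by
  choose s v e hv hr using h
  have hcount : ({0} ∪ ⋃ x, ⋃ j, Set.range (v x j)).Countable :=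
    (Set.countable_singleton 0).union
      (Set.countable_iUnion fun x => Set.countable_iUnion fun j => Set.countable_range _)
  obtain ⟨f, hf⟩ := hcount.exists_eq_range ⟨0, Or.inl rfl⟩
  have hex (n : ℕ) : ∃ e : ℝ, f n ∈ localizedEigenspace (H ω) γ e := by
    have hn : f n ∈ {0} ∪ ⋃ x, ⋃ j, Set.range (v x j) := hf ▸ Set.mem_range_self n
    rcases hn with hn | hn
    · rw [Set.mem_singleton_iff.1 hn]
      exact ⟨0, Submodule.zero_mem _⟩
    · simp only [Set.mem_iUnion, Set.mem_range] at hn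
      obtain ⟨x, j, k, hk⟩ := hn
      exact ⟨e x j k, hk ▸ hv x j k⟩
  choose e' he' using hex
  refine andersonLocalized_of_dense_span hd hA hγ he'
    (eq_top_of_delta_mem (Submodule.isClosed_topologicalClosure _) fun x => ?_)
  rw [← SetLike.mem_coe, Submodule.topologicalClosure_coe, Metric.mem_closure_iff]
  intro ε hε
  obtain ⟨j, hj⟩ := exists_nat_one_div_lt hε
  refine ⟨∑ k, v x j k, Submodule.sum_mem _ fun k _ => Submodule.subset_span ?_, ?_⟩
  · rw [← hf]
    exact Or.inr (Set.mem_iUnion₂.2 ⟨x, j, k, rfl⟩)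
  · rw [dist_eq_norm]
    exact (hr x j).trans_lt hj

lemma ae_andersonLocalized {d : ℕ} (hd : 0 < d) {Ω : Type*} [MeasurableSpace Ω]
    [AddAction (Fin d → ℤ) Ω] {μ : Measure Ω} [IsProbabilityMeasure μ]
    {H : Ω → L2 d →L[ℂ] L2 d} {E : Ω → ℝ} {u : Ω → L2 d}
    (hH : IsErgodicCovariantFamily μ H E u) {γ : ℝ} (hγ : 0 < γ)
    {Ωs : ℕ → Set Ω} (hΩmeas : ∀ i, MeasurableSet (Ωs i)) (hΩmono : Monotone Ωs)
    (hΩfull : μ (⋃ i, Ωs i) = 1) {A : ℕ → ℝ} (hnorm : ∀ i, ∀ ω ∈ Ωs i, ‖u ω‖ = 1)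
    (hdecay : ∀ i, ∀ ω ∈ Ωs i, ∀ n, ‖u ω n‖ ≤ A i * expWeight γ n) :
    ∀ᵐ ω ∂μ, AndersonLocalized (H ω) γ := by
  have hS := hH.measurePreserving
  have hloc : ∀ᵐ ω ∂μ, u ω ∈ localizedEigenspace (H ω) γ (E ω) := by
    have hU : ∀ᵐ ω ∂μ, ω ∈ ⋃ i, Ωs i :=
      (prob_compl_eq_zero_iff (MeasurableSet.iUnion hΩmeas)).2 hΩfull
    filter_upwards [hU, hH.eigen] with ω hω he
    obtain ⟨i, hi⟩ := Set.mem_iUnion.1 hω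
    exact ⟨he, A i, hdecay i ω hi⟩
  have hloc' : ∀ᵐ ω ∂μ, ∀ k : Fin d → ℤ,
      translate (-k) (u (k +ᵥ ω)) ∈ localizedEigenspace (H ω) γ (E (k +ᵥ ω)) := by
    refine ae_all_iff.2 fun k => ?_
    filter_upwards [(hS k).quasiMeasurePreserving.ae hloc] with ω hω
    obtain ⟨he, M, hM⟩ := hω
    refine ⟨hH.apply_translate_eigenvector he, |M| * Real.exp (γ * absZ k), fun n => ?_⟩
    rw [translate_neg_apply, mul_assoc]
    have h3 := expWeight_add_le hγ.le k n
    rw [add_comm k n] at h3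
    exact (hM _).trans (mul_le_mul (le_abs_self M) h3 (expWeight_pos _ _).le (abs_nonneg M))
  have hmain : ∀ᵐ ω ∂μ, ∀ (x : Fin d → ℤ) (j : ℕ),
      ω ∈ approxEvent H γ x (1 / ((j : ℝ) + 1)) := by
    refine ae_all_iff.2 fun x => ae_all_iff.2 fun j => ?_
    have hr : (0 : ℝ) < 1 / ((j : ℝ) + 1) := by positivity
    refine measure_compl_eq_zero_of_tight hS (a := fun ω n => ‖u ω n‖ ^ 2)
      (fun _ _ => sq_nonneg _) (measurableSet_approxEvent hH.measurable hγ x _) x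
      (pow_pos hr 2) ?_ fun ε hε => ?_
    · filter_upwards [hloc', hH.orthonormal] with ω hω hon s
      exact indicator_approxEvent_add_sum_le hr.le x hon hω s
    · have ht := tendsto_measure_iUnion_atTop (μ := μ) hΩmono
      rw [hΩfull] at ht
      have ht' := (ENNReal.tendsto_toReal ENNReal.one_ne_top).comp ht
      obtain ⟨i, hi⟩ := (ht'.eventually (lt_mem_nhds (sub_lt_self _ hε))).exists
      obtain ⟨R, hR⟩ := exists_box_le_sum_norm_sq (d := d) hγ (A i) hε
      exact ⟨Ωs i, hΩmeas i, hi.le, R, fun ω hω => hR _ (hnorm i ω hω) (hdecay i ω hω)⟩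
  filter_upwards [hmain] with ω hω
  exact andersonLocalized_of_forall_mem_approxEvent hd (hH.selfAdjoint ω) hγ hω

/-! ### The propagator in an eigenbasis -/

lemma propagator_apply_of_eigenvector {d : ℕ} {A : L2 d →L[ℂ] L2 d} {v : L2 d} {e : ℝ}
    (hv : A v = (e : ℂ) • v) (t : ℝ) :
    propagator A t v = Complex.exp (-(Complex.I * t) * e) • v := by
  have hpow (n : ℕ) : (((-(Complex.I * (t : ℂ))) • A) ^ n) v =
      (-(Complex.I * t) * (e : ℂ)) ^ n • v := by
    induction n with
    | zero => simp
    | succ n ih =>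
      rw [pow_succ, mul_apply_eq_comp, smul_apply, hv, smul_smul,
        map_smul, ih, smul_smul, pow_succ, mul_comm]
  have h1 := (ContinuousLinearMap.apply ℂ (L2 d) v).hasSum
    (NormedSpace.exp_series_hasSum_exp' (𝕂 := ℂ) ((-(Complex.I * (t : ℂ))) • A))
  have h2 := (NormedSpace.exp_series_hasSum_exp' (𝕂 := ℂ) (-(Complex.I * t) * (e : ℂ))).smul_const v
  rw [Complex.exp_eq_exp_ℂ]
  refine h1.unique ?_
  convert h2 using 2 with n
  rw [ContinuousLinearMap.apply_apply, smul_apply, hpow, smul_assoc]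

lemma hasSum_inner_smul_of_hasSum_norm_sq {E ι : Type*} [NormedAddCommGroup E]
    [InnerProductSpace ℂ E] {v : ι → E} (hv : Orthonormal ℂ v) {x : E}
    (h : HasSum (fun i => ‖inner ℂ (v i) x‖ ^ 2) (‖x‖ ^ 2)) :
    HasSum (fun i => inner ℂ (v i) x • v i) x := by
  have h1 := Tendsto.const_sub (‖x‖ ^ 2) h
  simp only [← norm_sub_sum_sq hv, sub_self] at h1
  have h2 := h1.sqrt
  simp only [Real.sqrt_sq (norm_nonneg _), Real.sqrt_zero] at h2
  refine tendsto_iff_norm_sub_tendsto_zero.2 ?_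
  simpa only [norm_sub_rev] using h2

lemma ofReal_norm_inner_propagator_le {d : ℕ} {ι : Type*} {A : L2 d →L[ℂ] L2 d} {v : ι → L2 d}
    (hv : Orthonormal ℂ v) {e : ι → ℝ} (he : ∀ j, A (v j) = (e j : ℂ) • v j) (k l : Fin d → ℤ)
    (hl : HasSum (fun j => ‖v j l‖ ^ 2) 1) (t : ℝ) :
    ENNReal.ofReal ‖inner ℂ (delta k) (propagator A t (delta l))‖ ≤
      ∑' j, ENNReal.ofReal (‖v j k‖ * ‖v j l‖) := by
  have h1 : HasSum (fun j => inner ℂ (v j) (delta l) • v j) (delta l) := by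
    refine hasSum_inner_smul_of_hasSum_norm_sq hv ?_
    simpa only [norm_inner_delta_right, norm_delta, one_pow] using hl
  have h2 := ((innerSL ℂ (delta k)).comp (propagator A t)).hasSum h1
  simp only [ContinuousLinearMap.comp_apply, innerSL_apply_apply] at h2
  rw [← h2.tsum_eq, ofReal_norm]
  refine enorm_tsum_le_tsum_enorm.trans (le_of_eq (tsum_congr fun j => ?_))
  have hphase : ‖Complex.exp (-(Complex.I * t) * e j)‖ = 1 := by
    rw [show -(Complex.I * t) * (e j : ℂ) = ((-(t * e j) : ℝ) : ℂ) * Complex.I by push_cast; ring]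
    exact Complex.norm_exp_ofReal_mul_I _
  rw [← ofReal_norm, map_smul, propagator_apply_of_eigenvector (he j),
    inner_smul_right, inner_smul_right, inner_delta, norm_mul, norm_mul,
    norm_inner_delta_right, hphase, one_mul, mul_comm]

/-! ### Completeness by mass transport -/

lemma measurable_coord {d : ℕ} {Ω : Type*} [MeasurableSpace Ω] {u : Ω → L2 d}
    (hu : Measurable[_, borel (L2 d)] u) (n : Fin d → ℤ) : Measurable fun ω => u ω n := by
  let _ : MeasurableSpace (L2 d) := borel (L2 d)
  have : BorelSpace (L2 d) := ⟨rfl⟩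
  exact (continuous_coord n).measurable.comp hu

/-- For measurable `u`, the expected mass `∑ₖ |u(Sₖω)(x + k)|²` received at `x` is the expected
norm of `u`, so that Bessel's inequality is an equality almost surely. -/
lemma ae_hasSum_norm_sq_eq_one {d : ℕ} {Ω : Type*} [MeasurableSpace Ω]
    [AddAction (Fin d → ℤ) Ω] {μ : Measure Ω} [IsProbabilityMeasure μ]
    {H : Ω → L2 d →L[ℂ] L2 d} {E : Ω → ℝ} {u : Ω → L2 d}
    (hH : IsErgodicCovariantFamily μ H E u) (hu : Measurable[_, borel (L2 d)] u)
    (x : Fin d → ℤ) :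
    ∀ᵐ ω ∂μ, HasSum (fun k => ‖u (k +ᵥ ω) (x + k)‖ ^ 2) 1 := by
  have hS := hH.measurePreserving
  have hmeas (n : Fin d → ℤ) : Measurable fun ω => ENNReal.ofReal (‖u ω n‖ ^ 2) :=
    ((measurable_coord hu n).norm.pow_const 2).ennreal_ofReal
  have hmeas' (k : Fin d → ℤ) :
      Measurable fun ω => ENNReal.ofReal (‖u (k +ᵥ ω) (x + k)‖ ^ 2) :=
    (hmeas (x + k)).comp (hS k).measurable
  have hbessel : ∀ᵐ ω ∂μ, Summable (fun k => ‖u (k +ᵥ ω) (x + k)‖ ^ 2) ∧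
      ∑' k, ‖u (k +ᵥ ω) (x + k)‖ ^ 2 ≤ 1 := by
    filter_upwards [hH.orthonormal] with ω hω
    have h1 := hω.inner_products_summable (delta x)
    have h2 := hω.tsum_inner_products_le (delta x)
    simp only [norm_inner_delta_right, translate_neg_apply, norm_delta, one_pow] at h1 h2
    exact ⟨h1, h2⟩
  have hint : ∫⁻ ω, ∑' k, ENNReal.ofReal (‖u (k +ᵥ ω) (x + k)‖ ^ 2) ∂μ = 1 := by
    rw [lintegral_tsum fun k => (hmeas' k).aemeasurable]
    calc ∑' k, ∫⁻ ω, ENNReal.ofReal (‖u (k +ᵥ ω) (x + k)‖ ^ 2) ∂μ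
        = ∑' k, ∫⁻ ω, ENNReal.ofReal (‖u ω (x + k)‖ ^ 2) ∂μ :=
          tsum_congr fun k => (hS k).lintegral_comp (hmeas (x + k))
      _ = ∑' n, ∫⁻ ω, ENNReal.ofReal (‖u ω n‖ ^ 2) ∂μ :=
          (Equiv.addLeft x).tsum_eq fun n => ∫⁻ ω, ENNReal.ofReal (‖u ω n‖ ^ 2) ∂μ
      _ = ∫⁻ ω, ∑' n, ENNReal.ofReal (‖u ω n‖ ^ 2) ∂μ :=
          (lintegral_tsum fun n => (hmeas n).aemeasurable).symm
      _ = ∫⁻ _, 1 ∂μ := lintegral_congr_ae <| by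
          filter_upwards [hH.normalized] with ω hω
          rw [tsum_ofReal_norm_sq, hω]
          simp
      _ = 1 := by simp
  have hle : (fun ω => ∑' k, ENNReal.ofReal (‖u (k +ᵥ ω) (x + k)‖ ^ 2)) ≤ᵐ[μ] fun _ => 1 := by
    filter_upwards [hbessel] with ω hω
    rw [← ENNReal.ofReal_tsum_of_nonneg (fun _ => sq_nonneg _) hω.1]
    exact ENNReal.ofReal_le_one.2 hω.2
  filter_upwards [hbessel, ae_eq_of_ae_le_of_lintegral_le hle
    (by rw [hint]; exact ENNReal.one_ne_top) aemeasurable_const (by rw [hint]; simp)] with ω hω h1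
  rw [← ENNReal.ofReal_tsum_of_nonneg (fun _ => sq_nonneg _) hω.1, ENNReal.ofReal_eq_one] at h1
  exact h1 ▸ hω.1.hasSum

/-! ### The eigenfunction correlator -/

/-- The bound of the transition amplitude by the correlator of the eigenfunctions, in
expectation and transported back to the single eigenfunction `u`. -/
lemma expectedSup_le_lintegral {d : ℕ} {Ω : Type*} [MeasurableSpace Ω]
    [AddAction (Fin d → ℤ) Ω] {μ : Measure Ω} [IsProbabilityMeasure μ]
    {H : Ω → L2 d →L[ℂ] L2 d} {E : Ω → ℝ} {u : Ω → L2 d}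
    (hH : IsErgodicCovariantFamily μ H E u) (hu : Measurable[_, borel (L2 d)] u)
    (k l : Fin d → ℤ) :
    expectedSup μ H k l ≤ ∫⁻ ω, ∑' j, ENNReal.ofReal (‖u ω (k + j)‖ * ‖u ω (l + j)‖) ∂μ := by
  have hS := hH.measurePreserving
  have hmeas (j : Fin d → ℤ) :
      Measurable fun ω => ENNReal.ofReal (‖u ω (k + j)‖ * ‖u ω (l + j)‖) :=
    ((measurable_coord hu _).norm.mul (measurable_coord hu _).norm).ennreal_ofReal
  have heigen : ∀ᵐ ω ∂μ, ∀ j : Fin d → ℤ,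
      H (j +ᵥ ω) (u (j +ᵥ ω)) = (E (j +ᵥ ω) : ℂ) • u (j +ᵥ ω) :=
    ae_all_iff.2 fun j => (hS j).quasiMeasurePreserving.ae hH.eigen
  calc expectedSup μ H k l
      ≤ ∫⁻ ω, ∑' j, ENNReal.ofReal (‖u (j +ᵥ ω) (k + j)‖ * ‖u (j +ᵥ ω) (l + j)‖) ∂μ := by
        refine lintegral_mono_ae ?_
        filter_upwards [heigen, hH.orthonormal, ae_hasSum_norm_sq_eq_one hH hu l] with ω he hon hl
        refine iSup_le fun t => ?_
        have h := ofReal_norm_inner_propagator_le hon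
          (fun j => hH.apply_translate_eigenvector (he j)) k l
          (by simpa only [translate_neg_apply] using hl) t
        simpa only [translate_neg_apply] using h
    _ = ∑' j, ∫⁻ ω, ENNReal.ofReal (‖u (j +ᵥ ω) (k + j)‖ * ‖u (j +ᵥ ω) (l + j)‖) ∂μ :=
        lintegral_tsum fun j => ((hmeas j).comp (hS j).measurable).aemeasurable
    _ = ∑' j, ∫⁻ ω, ENNReal.ofReal (‖u ω (k + j)‖ * ‖u ω (l + j)‖) ∂μ :=
        tsum_congr fun j => (hS j).lintegral_comp (hmeas j)
    _ = _ := (lintegral_tsum fun j => (hmeas j).aemeasurable).symm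

/-- The correlator of an eigenfunction with two peaks, at `0` and at `-p`. The mixed terms cost
the factor `e^{γ|p|}`, which the small height `c` of the second peak has to compensate. -/
lemma tsum_ofReal_norm_mul_norm_le {d : ℕ} {γ η C c : ℝ} (hη : 0 ≤ η) (hηγ : η ≤ γ)
    (hC : 0 ≤ C) (hc : 0 ≤ c) (hc1 : c ≤ 1) {p : Fin d → ℤ} {v : L2 d}
    (hv : ∀ n, ‖v n‖ ≤ C * (expWeight γ n + c * expWeight γ (n + p))) (k l : Fin d → ℤ) :
    ∑' j, ENNReal.ofReal (‖v (k + j)‖ * ‖v (l + j)‖) ≤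
      ENNReal.ofReal (C ^ 2) * (1 + ENNReal.ofReal (c * Real.exp (γ * absZ p))) *
        (ENNReal.ofReal (expWeight η (k - l)) *
          (2 * ∑' n : Fin d → ℤ, ENNReal.ofReal (expWeight (γ - η) n))) := by
  set b := c * Real.exp (γ * absZ p) with hb
  have hb0 : 0 ≤ b := by positivity
  set w := expWeight η (k - l) with hw
  have hw0 : 0 ≤ w := (expWeight_pos _ _).le
  have hexp : Real.exp (η * absZ p) ≤ Real.exp (γ * absZ p) :=
    Real.exp_le_exp.2 (mul_le_mul_of_nonneg_right hηγ (Nat.cast_nonneg _))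
  have hterm (j : Fin d → ℤ) : ‖v (k + j)‖ * ‖v (l + j)‖ ≤
      C ^ 2 * (1 + b) * w * (expWeight (γ - η) (l + j) + expWeight (γ - η) (l + p + j)) := by
    set s := expWeight (γ - η) (l + j)
    set s' := expWeight (γ - η) (l + p + j)
    have hs : 0 < s := expWeight_pos _ _
    have hs' : 0 < s' := expWeight_pos _ _
    have h1 := expWeight_mul_expWeight_le hη hηγ (k + j) (l + j)
    have h2 := expWeight_mul_expWeight_le hη hηγ (k + j + p) (l + j)
    have h3 := expWeight_mul_expWeight_le hη hηγ (k + j) (l + j + p)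
    have h4 := expWeight_mul_expWeight_le hη hηγ (k + j + p) (l + j + p)
    rw [show k + j - (l + j) = k - l by abel] at h1
    rw [show k + j + p - (l + j) = p + (k - l) by abel] at h2
    rw [show k + j - (l + j + p) = -p + (k - l) by abel,
      show l + j + p = l + p + j by abel] at h3
    rw [show k + j + p - (l + j + p) = k - l by abel, show l + j + p = l + p + j by abel] at h4
    have h5 : c * expWeight η (p + (k - l)) ≤ b * w := by
      rw [hb, mul_assoc]
      exact mul_le_mul_of_nonneg_left ((expWeight_add_le hη _ _).trans
        (mul_le_mul_of_nonneg_right hexp hw0)) hc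
    have h6 : c * expWeight η (-p + (k - l)) ≤ b * w := by
      rw [hb, mul_assoc]
      refine mul_le_mul_of_nonneg_left ((expWeight_add_le hη _ _).trans ?_) hc
      rw [absZ_neg]
      exact mul_le_mul_of_nonneg_right hexp hw0
    have h2' := (mul_le_mul_of_nonneg_left h2 hc).trans_eq (mul_assoc _ _ _).symm
      |>.trans (mul_le_mul_of_nonneg_right h5 hs.le)
    have h3' := (mul_le_mul_of_nonneg_left h3 hc).trans_eq (mul_assoc _ _ _).symm
      |>.trans (mul_le_mul_of_nonneg_right h6 hs'.le)
    have h4' : c * c * (expWeight γ (k + j + p) * expWeight γ (l + p + j)) ≤ w * s' :=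
      (mul_le_of_le_one_left (mul_nonneg (expWeight_pos _ _).le (expWeight_pos _ _).le)
        (mul_le_one₀ hc1 hc hc1)).trans h4
    have hbound : (expWeight γ (k + j) + c * expWeight γ (k + j + p)) *
        (expWeight γ (l + j) + c * expWeight γ (l + j + p)) ≤ (1 + b) * w * (s + s') := by
      rw [show l + j + p = l + p + j by abel]
      linear_combination h1 + h2' + h3' + h4'
    calc ‖v (k + j)‖ * ‖v (l + j)‖ ≤ _ := mul_le_mul (hv _) (hv _) (norm_nonneg _)
          (mul_nonneg hC (add_nonneg (expWeight_pos _ _).le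
            (mul_nonneg hc (expWeight_pos _ _).le)))
      _ = C ^ 2 * ((expWeight γ (k + j) + c * expWeight γ (k + j + p)) *
          (expWeight γ (l + j) + c * expWeight γ (l + j + p))) := by ring
      _ ≤ C ^ 2 * ((1 + b) * w * (s + s')) := mul_le_mul_of_nonneg_left hbound (sq_nonneg C)
      _ = _ := by ring
  have hshift (z : Fin d → ℤ) : ∑' j, ENNReal.ofReal (expWeight (γ - η) (z + j)) =
      ∑' n : Fin d → ℤ, ENNReal.ofReal (expWeight (γ - η) n) :=
    (Equiv.addLeft z).tsum_eq fun n => ENNReal.ofReal (expWeight (γ - η) n)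
  calc ∑' j, ENNReal.ofReal (‖v (k + j)‖ * ‖v (l + j)‖)
      ≤ ∑' j, ENNReal.ofReal (C ^ 2 * (1 + b) * w) *
          (ENNReal.ofReal (expWeight (γ - η) (l + j)) +
            ENNReal.ofReal (expWeight (γ - η) (l + p + j))) := by
        refine ENNReal.tsum_le_tsum fun j => ?_
        rw [← ENNReal.ofReal_add (expWeight_pos _ _).le (expWeight_pos _ _).le,
          ← ENNReal.ofReal_mul (by positivity)]
        exact ENNReal.ofReal_le_ofReal (hterm j)
    _ = ENNReal.ofReal (C ^ 2 * (1 + b) * w) *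
          (2 * ∑' n : Fin d → ℤ, ENNReal.ofReal (expWeight (γ - η) n)) := by
        rw [ENNReal.tsum_mul_left, ENNReal.tsum_add, hshift, hshift, two_mul]
    _ = _ := by
        rw [ENNReal.ofReal_mul (by positivity), ENNReal.ofReal_mul (sq_nonneg C),
          ENNReal.ofReal_add zero_le_one hb0, ENNReal.ofReal_one, mul_assoc]

/-- Layer-cake bound for a function controlled on an increasing exhaustion. -/
lemma lintegral_le_of_le_on_exhaustion {Ω : Type*} [MeasurableSpace Ω] {μ : Measure Ω}
    [IsProbabilityMeasure μ] {Ωs : ℕ → Set Ω} (hΩmeas : ∀ i, MeasurableSet (Ωs i))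
    (hΩfull : μ (⋃ i, Ωs i) = 1) {f : Ω → ℝ≥0∞} {K : ℕ → ℝ≥0∞}
    (hf : ∀ i, ∀ ω ∈ Ωs i, f ω ≤ K i) :
    ∫⁻ ω, f ω ∂μ ≤ K 0 + ∑' i, K (i + 1) * μ (Ωs i)ᶜ := by
  have hU : ∀ᵐ ω ∂μ, ω ∈ ⋃ i, Ωs i :=
    (prob_compl_eq_zero_iff (MeasurableSet.iUnion hΩmeas)).2 hΩfull
  have hpt : ∀ᵐ ω ∂μ, f ω ≤ K 0 + ∑' i, (Ωs i)ᶜ.indicator (fun _ => K (i + 1)) ω := by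
    filter_upwards [hU] with ω hω
    classical
    have hex := Set.mem_iUnion.1 hω
    rcases h : Nat.find hex with _ | i
    · exact (hf 0 ω (h ▸ Nat.find_spec hex)).trans le_self_add
    · have hi : ω ∈ (Ωs i)ᶜ := Nat.find_min hex (by omega)
      refine (hf (i + 1) ω (h ▸ Nat.find_spec hex)).trans (le_add_left ?_)
      refine le_trans (le_of_eq ?_) (ENNReal.le_tsum i)
      rw [Set.indicator_of_mem hi]
  refine (lintegral_mono_ae hpt).trans (le_of_eq ?_)
  rw [lintegral_add_left measurable_const, lintegral_tsum fun i =>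
    (measurable_const.indicator (hΩmeas i).compl).aemeasurable]
  simp [lintegral_indicator_const (hΩmeas _).compl]

/-! ### Decay rates -/

lemma le_decayRate {d : ℕ} {Ω : Type*} [MeasurableSpace Ω] {μ : Measure Ω}
    {H : Ω → L2 d →L[ℂ] L2 d} {γ : ℝ} (hγ : 0 < γ)
    (h : ∀ η, 0 < η → η < γ → ∃ D : ℝ, 0 < D ∧ ∀ k l : Fin d → ℤ,
      expectedSup μ H k l ≤ ENNReal.ofReal (D * Real.exp (-η * absZ (k - l)))) :
    (γ : EReal) ≤ decayRate μ H := by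
  refine EReal.ge_of_forall_gt_iff_ge.1 fun z hz => ?_
  rw [EReal.coe_lt_coe_iff] at hz
  obtain ⟨η, hη, hηγ⟩ := exists_between (max_lt hz hγ)
  obtain ⟨D, hD, hbound⟩ := h η ((le_max_right _ _).trans_lt hη) hηγ
  have hzη : 0 < η - z := sub_pos.2 ((le_max_left _ _).trans_lt hη)
  refine le_liminf_of_le (by isBoundedDefault) ?_
  filter_upwards [(tendsto_absZ_cofinite d).eventually_gt_atTop 0,
    ((tendsto_natCast_atTop_atTop (R := ℝ)).comp (tendsto_absZ_cofinite d)).eventually_ge_atTop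
      (Real.log D / (η - z))] with n hn0 hn
  rw [Function.comp_apply, div_le_iff₀ hzη] at hn
  rw [EReal.le_div_iff_mul_le (by exact_mod_cast hn0) (EReal.coe_ne_top _), ← EReal.coe_mul,
    EReal.le_neg]
  have h1 := ENNReal.log_monotone (hbound n 0)
  rw [ENNReal.log_ofReal, if_neg (not_le.2 (by positivity)), sub_zero,
    Real.log_mul hD.ne' (Real.exp_pos _).ne', Real.log_exp] at h1
  refine h1.trans ?_
  rw [← EReal.coe_neg, EReal.coe_le_coe_iff]
  linarith

end EDL

/-! ### Localization of ergodic covariant families -/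

theorem theorem1p4 {d : ℕ} (hd : 0 < d) {Ω : Type*} [MeasurableSpace Ω]
    [AddAction (Fin d → ℤ) Ω] (μ : Measure Ω) [IsProbabilityMeasure μ]
    (H : Ω → EDL.L2 d →L[ℂ] EDL.L2 d) (E : Ω → ℝ) (u : Ω → EDL.L2 d)
    (hH : EDL.IsErgodicCovariantFamily μ H E u)
    (γ : ℝ) (hγ : 0 < γ)
    -- condition (1)
    (Ωs : ℕ → Set Ω) (hΩmeas : ∀ i, MeasurableSet (Ωs i)) (hΩmono : Monotone Ωs)
    (hΩfull : μ (⋃ i, Ωs i) = 1)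
    (N : ℕ → ℕ) (C : ℕ → ℝ) (c : ℕ → ℕ → ℝ)
    (hgood : ∀ i, ∀ ω ∈ Ωs i, ∃ ℓ : Fin d → ℤ, EDL.absZ ℓ < N i ∧
      EDL.IsGoodEigenfunction (H ω) γ ℓ (C i) (c i (EDL.absZ ℓ)) (u ω)) :
    -- condition (1) alone gives Anderson localization
    (∀ᵐ ω ∂μ, EDL.AndersonLocalized (H ω) γ) ∧
    -- conditions (1), (2), (3) give exponential dynamical localization in expectation
    (Measurable[_, borel (EDL.L2 d)] u →
      (∑' i : ℕ, ENNReal.ofReal (C (i + 1) ^ 2) *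
        (1 + ⨆ m : Fin (N (i + 1)), ENNReal.ofReal (c (i + 1) m * Real.exp (γ * (m : ℕ)))) *
        μ (Ωs i)ᶜ < ∞) →
      EDL.HasEDL μ H ∧ (γ : EReal) ≤ EDL.decayRate μ H) := by
  -- On `Ωs i` the second peak is within distance `N i` of the first, so both are dominated by a
  -- single peak at the origin with a uniform constant.
  have hdecay : ∀ i, ∀ ω ∈ Ωs i, ∀ n,
      ‖u ω n‖ ≤ C i * (1 + Real.exp (γ * N i)) * EDL.expWeight γ n := by
    intro i ω hω n
    obtain ⟨ℓ, hℓ, hg⟩ := hgood i ω hω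
    refine (hg.bound n).trans ?_
    rw [mul_assoc, one_add_mul]
    refine mul_le_mul_of_nonneg_left (add_le_add_right ?_ _) hg.C_pos.le
    have h1 : EDL.expWeight γ (n + ℓ) ≤ Real.exp (γ * N i) * EDL.expWeight γ n := by
      rw [add_comm]
      refine (EDL.expWeight_add_le hγ.le ℓ n).trans
        (mul_le_mul_of_nonneg_right (Real.exp_le_exp.2 ?_) (EDL.expWeight_pos _ _).le)
      exact mul_le_mul_of_nonneg_left (by exact_mod_cast hℓ.le) hγ.le
    exact (mul_le_of_le_one_left (EDL.expWeight_pos _ _).le hg.c_lt_one.le).trans h1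
  have hnorm : ∀ i, ∀ ω ∈ Ωs i, ‖u ω‖ = 1 := fun i ω hω =>
    (hgood i ω hω).elim fun _ h => h.2.normalized
  refine ⟨EDL.ae_andersonLocalized hd hH hγ hΩmeas hΩmono hΩfull hnorm hdecay,
    fun hu hsum => ?_⟩
  let K (i : ℕ) : ℝ≥0∞ := ENNReal.ofReal (C i ^ 2) *
    (1 + ⨆ m : Fin (N i), ENNReal.ofReal (c i m * Real.exp (γ * (m : ℕ))))
  have hT : K 0 + ∑' i, K (i + 1) * μ (Ωs i)ᶜ ≠ ∞ := by
    refine ENNReal.add_ne_top.2 ⟨ENNReal.mul_ne_top ENNReal.ofReal_ne_top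
      (ENNReal.add_ne_top.2 ⟨ENNReal.one_ne_top, ?_⟩), hsum.ne⟩
    refine ne_top_of_le_ne_top (ENNReal.sum_ne_top.2 fun m _ => ENNReal.ofReal_ne_top)
      (iSup_le fun m => Finset.single_le_sum
        (f := fun m : Fin (N 0) => ENNReal.ofReal (c 0 m * Real.exp (γ * (m : ℕ))))
        (fun _ _ => zero_le) (Finset.mem_univ m))
  have hrate : ∀ η, 0 < η → η < γ → ∃ D : ℝ, 0 < D ∧ ∀ k l : Fin d → ℤ,
      EDL.expectedSup μ H k l ≤
        ENNReal.ofReal (D * Real.exp (-η * EDL.absZ (k - l))) := by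
    intro η hη hηγ
    set S : ℝ≥0∞ := 2 * ∑' n : Fin d → ℤ, ENNReal.ofReal (EDL.expWeight (γ - η) n) with hSdef
    have hS : S ≠ ∞ := ENNReal.mul_ne_top ENNReal.ofNat_ne_top
      (EDL.summable_expWeight (sub_pos.2 hηγ) d).tsum_ofReal_ne_top
    set D : ℝ≥0∞ := (K 0 + ∑' i, K (i + 1) * μ (Ωs i)ᶜ) * S with hD
    have hDtop : D ≠ ∞ := ENNReal.mul_ne_top hT hS
    refine ⟨D.toReal + 1, by positivity, fun k l => ?_⟩
    set w := ENNReal.ofReal (EDL.expWeight η (k - l)) with hw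
    have hpt : ∀ i, ∀ ω ∈ Ωs i,
        ∑' j, ENNReal.ofReal (‖u ω (k + j)‖ * ‖u ω (l + j)‖) ≤ K i * (w * S) := by
      intro i ω hω
      obtain ⟨ℓ, hℓ, hg⟩ := hgood i ω hω
      refine (EDL.tsum_ofReal_norm_mul_norm_le hη.le hηγ.le hg.C_pos.le hg.c_pos.le
        hg.c_lt_one.le hg.bound k l).trans (mul_le_mul_left (mul_le_mul_right ?_ _) _)
      exact add_le_add_right (le_iSup
        (fun m : Fin (N i) => ENNReal.ofReal (c i m * Real.exp (γ * (m : ℕ))))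
        ⟨EDL.absZ ℓ, hℓ⟩) _
    calc EDL.expectedSup μ H k l
        ≤ ∫⁻ ω, ∑' j, ENNReal.ofReal (‖u ω (k + j)‖ * ‖u ω (l + j)‖) ∂μ :=
          EDL.expectedSup_le_lintegral hH hu k l
      _ ≤ K 0 * (w * S) + ∑' i, K (i + 1) * (w * S) * μ (Ωs i)ᶜ :=
          EDL.lintegral_le_of_le_on_exhaustion hΩmeas hΩfull hpt
      _ = D * w := by
          simp only [mul_right_comm _ (w * S)]
          rw [ENNReal.tsum_mul_right, ← add_mul, hD]
          ring
      _ ≤ ENNReal.ofReal (D.toReal + 1) * w := by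
          refine mul_le_mul_left ?_ _
          rw [← ENNReal.ofReal_toReal hDtop]
          exact ENNReal.ofReal_le_ofReal (by simp)
      _ = _ := by
          rw [hw, ← ENNReal.ofReal_mul (by positivity)]
          rfl
  obtain ⟨D, hD, hbound⟩ := hrate (γ / 2) (half_pos hγ) (half_lt_self hγ)
  exact ⟨⟨D, γ / 2, hD, half_pos hγ, hbound⟩, EDL.le_decayRate hγ hrate⟩
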